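/- For $w,o,q\in\mathbb{R}^d$ let $d_w^{l_1}(o,q)=\sum_{i=1}^d w_i|o_i-q_i|$ be the generalized weighted Manhattan distance; the weights may be any real numbers, of either sign. An LSH family on $\mathbb{R}^d$ is a random function $h:\mathbb{R}^d\to B$ into some set $B$ of buckets. An ALSH family is a random pair $(f,g)$ of functions into a set $B$ of buckets, where $f$ hashes data points $o\in\mathbb{R}^d$ and $g$ hashes queries. (All collision events $h(o)=h(q)$, respectively $f(o)=g(q)$, are assumed measurable.) For a distance function $\mathrm{dist}$ such a family is $(R_1,R_2,P_1,P_2)$-sensitive if $R_1<R_2$, $P_1>P_2$, and for all data points $o$ and all queries $q$ the collision probability is at least $P_1$ whenever $\mathrm{dist}(o,q)\le R_1$ and at most $P_2$ whenever $\mathrm{dist}(o,q)\ge R_2$. Let $d\ge 3$ and let $R_1<R_2$ and $P_1>P_2$ be real numbers. Then there is no $(R_1,R_2,P_1,P_2)$-sensitive LSH or ALSH family for $d_w^{l_1}$ with data points and query points ranging over all of $\mathbb{R}^d$ and weights specified along with the query point. That is: 1. There is no LSH family $h$ on $\mathbb{R}^d$ that is $(R_1,R_2,P_1,P_2)$-sensitive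 for $d_w^{l_1}$ for every $w\in\mathbb{R}^d$. 2. There is no $(R_1,R_2,P_1,P_2)$-sensitive ALSH family $(f,g)$ for the queries $(q,w)\in\mathbb{R}^d\times\mathbb{R}^d$ and the distance $(o,(q,w))\mapsto d_w^{l_1}(o,q)$; here $g$ may depend on the weight vector $w$ as well as on $q$. 3. Moreover, one fixed weight vector suffices: there is $w\in\mathbb{R}^d$ (which may depend on $d,R_1,R_2,P_1,P_2$) such that neither an LSH family nor an ALSH family, with data points and queries ranging over $\mathbb{R}^d$, is $(R_1,R_2,P_1,P_2)$-sensitive for the single distance function $d_w^{l_1}$. -/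

import Mathlib

open MeasureTheory

universe uΩ uB uZ uQ

/-- The generalized weighted Manhattan distance `∑ i, w i * |o i - q i|` on `ℝ^d`.  The weights are
arbitrary reals, so its values may be negative. -/
def weightedManhattan {d : ℕ} (w o q : Fin d → ℝ) : ℝ :=
  ∑ i, w i * |o i - q i|

/-- An LSH family of hash functions `Z → B` (`B` is the set of bucket IDs): a random function
`h : Z → B`, given on a probability space, for which every collision event `h o = h q` is an
event. -/
structure LSHFamily (Z : Type uZ) (B : Type uB) where
  /-- the sample space from which the hash function is drawn -/
  Ω : Type uΩ
  /-- its events -/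
  mΩ : MeasurableSpace Ω
  /-- the law according to which the hash function is drawn -/
  μ : Measure Ω
  isProb : IsProbabilityMeasure μ
  /-- the hash functions -/
  h : Ω → Z → B
  measurableSet_collision : ∀ o q : Z, MeasurableSet {ω | h ω o = h ω q}

/-- The collision probability `Pr[h(o) = h(q)]`. -/
noncomputable def LSHFamily.collisionProb {Z : Type uZ} {B : Type uB}
    (H : LSHFamily.{uΩ} Z B) (o q : Z) : ℝ :=
  (H.μ {ω | H.h ω o = H.h ω q}).toReal

/-- `(R₁, R₂, P₁, P₂)`-sensitivity of an LSH family for the distance function `dist`, with data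
points in `X` and query points in `Y`. -/
def LSHFamily.IsSensitive {Z : Type uZ} {B : Type uB} (H : LSHFamily.{uΩ} Z B)
    (dist : Z → Z → ℝ) (X Y : Set Z) (R₁ R₂ P₁ P₂ : ℝ) : Prop :=
  (∀ o ∈ X, ∀ q ∈ Y,
    (dist o q ≤ R₁ → P₁ ≤ H.collisionProb o q) ∧
    (R₂ ≤ dist o q → H.collisionProb o q ≤ P₂)) ∧
  R₁ < R₂ ∧ P₂ < P₁

/-- An ALSH family: a random pair `(f, g)` of a hash function `f : Z → B` for data points and a hash
function `g : Q → B` for queries, drawn jointly from a probability space, for which every collision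
event `f o = g q` is an event.  The space `Q` of queries may differ from the space `Z` of data
points, since a query may carry more information than a point (a weight vector). -/
structure ALSHFamily (Z : Type uZ) (Q : Type uQ) (B : Type uB) where
  /-- the sample space from which the pair of hash functions is drawn -/
  Ω : Type uΩ
  /-- its events -/
  mΩ : MeasurableSpace Ω
  /-- the law according to which the pair of hash functions is drawn -/
  μ : Measure Ω
  isProb : IsProbabilityMeasure μ
  /-- the hash functions for data points -/
  f : Ω → Z → B
  /-- the hash functions for queries -/
  g : Ω → Q → B
  measurableSet_collision : ∀ (o : Z) (q : Q), MeasurableSet {ω | f ω o = g ω q}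

/-- The collision probability `Pr[f(o) = g(q)]`. -/
noncomputable def ALSHFamily.collisionProb {Z : Type uZ} {Q : Type uQ} {B : Type uB}
    (H : ALSHFamily.{uΩ} Z Q B) (o : Z) (q : Q) : ℝ :=
  (H.μ {ω | H.f ω o = H.g ω q}).toReal

/-- `(R₁, R₂, P₁, P₂)`-sensitivity of an ALSH family for the distance function `dist`, with data
points in `X` and queries in `Y`. -/
def ALSHFamily.IsSensitive {Z : Type uZ} {Q : Type uQ} {B : Type uB}
    (H : ALSHFamily.{uΩ} Z Q B) (dist : Z → Q → ℝ) (X : Set Z) (Y : Set Q)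
    (R₁ R₂ P₁ P₂ : ℝ) : Prop :=
  (∀ o ∈ X, ∀ q ∈ Y,
    (dist o q ≤ R₁ → P₁ ≤ H.collisionProb o q) ∧
    (R₂ ≤ dist o q → H.collisionProb o q ≤ P₂)) ∧
  R₁ < R₂ ∧ P₂ < P₁

/-!
Give two coordinates the weights `1` and `-1` and the others the weight `0`. Data points `o i` on
the first of the two axes and queries `q j` on the second can be chosen with
`dist (o i) (q j) = R₁ + (R₂ - R₁) * (i - j)`. A sensitive family therefore has collision
probability at least `P₁` at `(o i, q j)` and at most `P₂` at `(o j, q i)` for all `i < j`.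

For each single pair `(f, g)` of hash functions the collision matrix is a disjoint union of
combinatorial rectangles, and Hilbert's inequality for the matrix `1 / (j - i)` bounds
`∑ i < N, ∑ j < N, [f i = g j] / (j - i)` by `π * N` (`sum_collision_div_sub_le`). The inequality comes
from `∫ x in 0..2π, (π - x) * sin (m * x) = 2π / m` and the orthogonality of characters. Taking
expectations, `(P₁ - P₂) * ∑ i < j < N, 1 / (j - i) ≤ π * N`, whereas the left side grows like
`N * log N` by the divergence of the harmonic series (`not_halfGraph_collision`).

A family of any of the other kinds induces an ALSH family for this single weight vector.
-/

open Finset Real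

/-! ### Hilbert's inequality for collision matrices -/

lemma sin_int_mul_two_mul_pi (m : ℤ) : sin (m * (2 * π)) = 0 := by
  have := sin_int_mul_pi (2 * m)
  push_cast at this
  rw [← this]
  ring_nf

lemma integral_cos_int_mul (m : ℤ) :
    ∫ x in (0 : ℝ)..2 * π, cos (m * x) = if m = 0 then 2 * π else 0 := by
  split_ifs with h
  · simp [h]
  · have hm : (m : ℝ) ≠ 0 := by exact_mod_cast h
    rw [intervalIntegral.integral_comp_mul_left (fun x => cos x) hm, integral_cos,
      sin_int_mul_two_mul_pi]
    simp

/-- The Hilbert matrix entry `1 / m` as a Fourier coefficient of a bounded function; at `m = 0` both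
sides are `0`, the right one by the convention for division by zero. -/
lemma integral_pi_sub_mul_sin_int_mul (m : ℤ) :
    ∫ x in (0 : ℝ)..2 * π, (π - x) * sin (m * x) = 2 * π / m := by
  rcases eq_or_ne m 0 with rfl | h
  · simp
  have hm : (m : ℝ) ≠ 0 := by exact_mod_cast h
  have hderiv : ∀ x ∈ Set.uIcc 0 (2 * π),
      HasDerivAt (fun x : ℝ => (x - π) * cos (m * x) / m - sin (m * x) / m ^ 2)
        ((π - x) * sin (m * x)) x := by
    intro x _
    have hlin : HasDerivAt (fun x : ℝ => (m : ℝ) * x) m x := by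
      simpa using (hasDerivAt_id x).const_mul (m : ℝ)
    have hsub : HasDerivAt (fun x : ℝ => x - π) 1 x := by
      simpa using (hasDerivAt_id x).sub_const π
    refine (((hsub.mul hlin.cos).div_const (m : ℝ)).sub
      (hlin.sin.div_const ((m : ℝ) ^ 2))).congr_deriv ?_
    field_simp
    ring
  rw [intervalIntegral.integral_eq_sub_of_hasDerivAt hderiv
    (Continuous.intervalIntegrable (by fun_prop) _ _)]
  simp only [sin_int_mul_two_mul_pi, cos_int_mul_two_pi]
  simp
  ring

open Classical in
/-- A collision matrix is a sum over the buckets of rank one matrices. -/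
lemma sum_collision_mul_eq {ι κ B : Type*} (s : Finset ι) (t : Finset κ) (f : ι → B) (g : κ → B)
    (a : ι → ℝ) (c : κ → ℝ) {T : Finset B} (hT : ∀ i ∈ s, f i ∈ T) :
    ∑ i ∈ s, ∑ j ∈ t, (if f i = g j then a i * c j else 0) =
      ∑ b ∈ T, (∑ i ∈ s, if f i = b then a i else 0) * ∑ j ∈ t, if g j = b then c j else 0 := by
  simp_rw [sum_mul_sum]
  rw [sum_comm]
  refine Eq.trans ?_ sum_comm.symm
  rw [sum_comm]
  refine sum_congr rfl fun i hi => ?_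
  rw [sum_comm]
  refine sum_congr rfl fun j _ => ?_
  rw [sum_eq_single_of_mem (f i) (hT i hi)]
  · by_cases h : f i = g j
    · simp [h]
    · simp [h, Ne.symm h]
  · intro b _ hb
    simp [Ne.symm hb]

open Classical in
/-- The integrand of Hilbert's inequality: Cauchy's inequality in every bucket for the vectors
`∑ exp (I * θ i)` over the data points, respectively queries, in that bucket. -/
lemma two_mul_sum_collision_sin_le {ι B : Type*} (s : Finset ι) (f g : ι → B) (θ : ι → ℝ)
    {r R : ℝ} (hr : |r| ≤ R) :
    2 * ∑ i ∈ s, ∑ j ∈ s, (if f i = g j then r * sin (θ j - θ i) else 0) ≤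
      R * ((∑ i ∈ s, ∑ j ∈ s, if f i = f j then cos (θ j - θ i) else 0) +
        ∑ i ∈ s, ∑ j ∈ s, if g i = g j then cos (θ j - θ i) else 0) := by
  set T : Finset B := s.image f ∪ s.image g with hTdef
  have hf : ∀ i ∈ s, f i ∈ T := fun i hi => mem_union_left _ (mem_image_of_mem f hi)
  have hg : ∀ i ∈ s, g i ∈ T := fun i hi => mem_union_right _ (mem_image_of_mem g hi)
  have hcos : ∀ k : ι → B, (∀ i ∈ s, k i ∈ T) →
      (∑ i ∈ s, ∑ j ∈ s, if k i = k j then cos (θ j - θ i) else 0) =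
        ∑ b ∈ T, ((∑ i ∈ s, if k i = b then cos (θ i) else 0) ^ 2 +
          (∑ i ∈ s, if k i = b then sin (θ i) else 0) ^ 2) := by
    intro k hk
    simp_rw [sq, sum_add_distrib, ← sum_collision_mul_eq s s k k _ _ hk, ← sum_add_distrib]
    refine sum_congr rfl fun i _ => sum_congr rfl fun j _ => ?_
    split_ifs
    · rw [cos_sub]; ring
    · simp
  have hsin : (∑ i ∈ s, ∑ j ∈ s, if f i = g j then r * sin (θ j - θ i) else 0) =
      ∑ b ∈ T, r * ((∑ i ∈ s, if f i = b then cos (θ i) else 0) *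
          (∑ j ∈ s, if g j = b then sin (θ j) else 0) -
        (∑ i ∈ s, if f i = b then sin (θ i) else 0) *
          (∑ j ∈ s, if g j = b then cos (θ j) else 0)) := by
    rw [← mul_sum, sum_sub_distrib, ← sum_collision_mul_eq s s f g _ _ hf,
      ← sum_collision_mul_eq s s f g _ _ hf]
    simp_rw [← sum_sub_distrib, mul_sum]
    refine sum_congr rfl fun i _ => sum_congr rfl fun j _ => ?_
    split_ifs
    · rw [sin_sub]; ring
    · simp
  rw [hcos f hf, hcos g hg, hsin, ← sum_add_distrib, mul_sum, mul_sum]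
  refine sum_le_sum fun b _ => ?_
  generalize (∑ i ∈ s, if f i = b then cos (θ i) else 0) = x
  generalize (∑ i ∈ s, if f i = b then sin (θ i) else 0) = y
  generalize (∑ i ∈ s, if g i = b then cos (θ i) else 0) = z
  generalize (∑ i ∈ s, if g i = b then sin (θ i) else 0) = u
  obtain ⟨h1, h2⟩ := abs_le.mp hr
  -- The difference of the two sides is the half sum of these two products.
  have e1 : 0 ≤ (R + r) * ((x - u) ^ 2 + (y + z) ^ 2) := mul_nonneg (by linarith) (by positivity)
  have e2 : 0 ≤ (R - r) * ((x + u) ^ 2 + (y - z) ^ 2) := mul_nonneg (by linarith) (by positivity)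
  linarith

open Classical in
/-- Hilbert's inequality for collision matrices; the diagonal terms are `0` because `1 / 0 = 0`. -/
lemma sum_collision_div_sub_le {B : Type*} (f g : ℕ → B) (N : ℕ) :
    ∑ i ∈ range N, ∑ j ∈ range N, (if f i = g j then 1 / ((j : ℝ) - i) else 0) ≤ π * N := by
  have hsin : ∫ x in (0 : ℝ)..2 * π, 2 * ∑ i ∈ range N, ∑ j ∈ range N,
        (if f i = g j then (π - x) * sin (j * x - i * x) else 0) =
      4 * π * ∑ i ∈ range N, ∑ j ∈ range N, (if f i = g j then 1 / ((j : ℝ) - i) else 0) := by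
    have hc : ∀ i j : ℕ, Continuous fun x : ℝ =>
        if f i = g j then (π - x) * sin (j * x - i * x) else 0 := by
      intro i j
      split_ifs <;> fun_prop
    rw [intervalIntegral.integral_const_mul, intervalIntegral.integral_finsetSum
      fun i _ => (continuous_finsetSum _ fun j _ => hc i j).intervalIntegrable _ _, mul_sum, mul_sum]
    refine sum_congr rfl fun i _ => ?_
    rw [intervalIntegral.integral_finsetSum fun j _ => (hc i j).intervalIntegrable _ _,
      mul_sum, mul_sum]
    refine sum_congr rfl fun j _ => ?_
    split_ifs
    · have := integral_pi_sub_mul_sin_int_mul ((j : ℤ) - i)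
      push_cast at this
      simp_rw [← sub_mul, this]
      ring
    · simp
  have hcos : ∀ k : ℕ → B, Continuous (fun x : ℝ => ∑ i ∈ range N, ∑ j ∈ range N,
        (if k i = k j then cos (j * x - i * x) else 0)) ∧
      ∫ x in (0 : ℝ)..2 * π, ∑ i ∈ range N, ∑ j ∈ range N,
        (if k i = k j then cos (j * x - i * x) else 0) = 2 * π * N := by
    intro k
    have hc : ∀ i j : ℕ, Continuous fun x : ℝ =>
        if k i = k j then cos (j * x - i * x) else 0 := by
      intro i j
      split_ifs <;> fun_prop
    refine ⟨continuous_finsetSum _ fun i _ => continuous_finsetSum _ fun j _ => hc i j, ?_⟩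
    rw [intervalIntegral.integral_finsetSum
      fun i _ => (continuous_finsetSum _ fun j _ => hc i j).intervalIntegrable _ _]
    have hrow : ∀ i ∈ range N, ∫ x in (0 : ℝ)..2 * π, ∑ j ∈ range N,
        (if k i = k j then cos (j * x - i * x) else 0) = 2 * π := by
      intro i hi
      rw [intervalIntegral.integral_finsetSum fun j _ => (hc i j).intervalIntegrable _ _,
        sum_eq_single_of_mem i hi]
      · simp
      · intro j _ hj
        split_ifs
        · have := integral_cos_int_mul ((j : ℤ) - i)
          rw [if_neg (by omega)] at this
          push_cast at this
          simp_rw [← sub_mul, this]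
        · simp
    rw [sum_congr rfl hrow]
    simp [mul_comm]
  have hmono : ∫ x in (0 : ℝ)..2 * π, 2 * ∑ i ∈ range N, ∑ j ∈ range N,
        (if f i = g j then (π - x) * sin (j * x - i * x) else 0) ≤
      ∫ x in (0 : ℝ)..2 * π, π * ((∑ i ∈ range N, ∑ j ∈ range N,
          if f i = f j then cos (j * x - i * x) else 0) +
        ∑ i ∈ range N, ∑ j ∈ range N, if g i = g j then cos (j * x - i * x) else 0) := by
    refine intervalIntegral.integral_mono_on (by positivity) ?_ ?_ ?_
    · refine Continuous.intervalIntegrable (continuous_const.mul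
        (continuous_finsetSum _ fun i _ => continuous_finsetSum _ fun j _ => ?_)) _ _
      split_ifs <;> fun_prop
    · exact (continuous_const.mul ((hcos f).1.add (hcos g).1)).intervalIntegrable _ _
    · intro x hx
      refine two_mul_sum_collision_sin_le (range N) f g (fun i => i * x) ?_
      rw [abs_le]
      constructor <;> linarith [hx.1, hx.2]
  rw [hsin, intervalIntegral.integral_const_mul, intervalIntegral.integral_add
    ((hcos f).1.intervalIntegrable _ _) ((hcos g).1.intervalIntegrable _ _),
    (hcos f).2, (hcos g).2] at hmono
  have : 4 * π * (∑ i ∈ range N, ∑ j ∈ range N, (if f i = g j then 1 / ((j : ℝ) - i) else 0)) ≤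
      4 * π * (π * N) := by linarith
  exact le_of_mul_le_mul_left this (by positivity)

/-! ### Collision probabilities cannot follow a half graph -/

/-- Hilbert's inequality in expectation. -/
lemma ALSHFamily.sum_collisionProb_div_sub_le {Z : Type uZ} {Q : Type uQ} {B : Type uB}
    (H : ALSHFamily.{uΩ} Z Q B) (o : ℕ → Z) (q : ℕ → Q) (N : ℕ) :
    ∑ i ∈ range N, ∑ j ∈ range N, H.collisionProb (o i) (q j) * (1 / ((j : ℝ) - i)) ≤ π * N := by
  classical
  let _ := H.mΩ
  have _ := H.isProb
  have hint : ∀ i j : ℕ, Integrable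
      ({ω | H.f ω (o i) = H.g ω (q j)}.indicator fun _ => 1 / ((j : ℝ) - i)) H.μ :=
    fun i j => (integrable_const _).indicator (H.measurableSet_collision _ _)
  have heq : ∑ i ∈ range N, ∑ j ∈ range N, H.collisionProb (o i) (q j) * (1 / ((j : ℝ) - i)) =
      ∫ ω, ∑ i ∈ range N, ∑ j ∈ range N,
        {ω | H.f ω (o i) = H.g ω (q j)}.indicator (fun _ => 1 / ((j : ℝ) - i)) ω ∂H.μ := by
    rw [integral_finsetSum _ fun i _ => integrable_finsetSum _ fun j _ => hint i j]
    refine sum_congr rfl fun i _ => ?_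
    rw [integral_finsetSum _ fun j _ => hint i j]
    refine sum_congr rfl fun j _ => ?_
    rw [integral_indicator_const _ (H.measurableSet_collision _ _)]
    rfl
  rw [heq]
  calc _ ≤ ∫ _, π * N ∂H.μ := by
        refine integral_mono
          (integrable_finsetSum _ fun i _ => integrable_finsetSum _ fun j _ => hint i j)
          (integrable_const _) fun ω => ?_
        have := sum_collision_div_sub_le (fun i => H.f ω (o i)) (fun j => H.g ω (q j)) N
        simpa only [Set.indicator_apply, Set.mem_ofPred_eq] using this
    _ = π * N := by simp

/-- The weight of the Hilbert matrix above the diagonal grows faster than linearly. -/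
lemma exists_mul_lt_sum_one_div_sub (C : ℝ) :
    ∃ N : ℕ, C * N < ∑ j ∈ range N, ∑ i ∈ range j, 1 / ((j : ℝ) - i) := by
  have hrow : ∀ j : ℕ, ∑ i ∈ range j, 1 / ((j : ℝ) - i) = ∑ k ∈ range j, 1 / ((k : ℝ) + 1) := by
    intro j
    rw [← sum_range_reflect]
    refine sum_congr rfl fun k hk => ?_
    have hk := mem_range.mp hk
    rw [Nat.sub_sub, Nat.cast_sub (by omega)]
    push_cast
    congr 1
    ring
  obtain ⟨M, hM0, hM⟩ := ((Filter.eventually_gt_atTop 0).and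
    (tendsto_sum_range_one_div_nat_succ_atTop.eventually_gt_atTop (2 * C))).exists
  have hM0' : (0 : ℝ) < M := by exact_mod_cast hM0
  -- The rows in `[M, 2M)` alone contribute at least `M` times the `M`-th harmonic number.
  refine ⟨2 * M, ?_⟩
  simp_rw [hrow]
  calc C * ((2 * M : ℕ) : ℝ) = M * (2 * C) := by push_cast; ring
    _ < M * ∑ k ∈ range M, 1 / ((k : ℝ) + 1) := by gcongr
    _ = ∑ _j ∈ Ico M (2 * M), ∑ k ∈ range M, 1 / ((k : ℝ) + 1) := by
        rw [sum_const, Nat.card_Ico, nsmul_eq_mul, two_mul, Nat.add_sub_cancel]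
    _ ≤ ∑ j ∈ Ico M (2 * M), ∑ k ∈ range j, 1 / ((k : ℝ) + 1) := by
        refine sum_le_sum fun j hj => ?_
        exact sum_le_sum_of_subset_of_nonneg (range_mono (mem_Ico.mp hj).1)
          fun k _ _ => by positivity
    _ ≤ ∑ j ∈ range (2 * M), ∑ k ∈ range j, 1 / ((k : ℝ) + 1) := by
        refine sum_le_sum_of_subset_of_nonneg (fun j hj => ?_) fun j _ _ => by positivity
        exact mem_range.mpr (mem_Ico.mp hj).2

/-- A double sum whose diagonal vanishes, rearranged over unordered pairs. -/
lemma sum_range_sum_range_eq_of_diag {a : ℕ → ℕ → ℝ} (ha : ∀ i, a i i = 0) (N : ℕ) :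
    ∑ i ∈ range N, ∑ j ∈ range N, a i j = ∑ j ∈ range N, ∑ i ∈ range j, (a i j + a j i) := by
  induction N with
  | zero => simp
  | succ n ih =>
    rw [sum_range_succ, sum_range_succ (fun j => ∑ i ∈ range j, (a i j + a j i)), ← ih,
      sum_range_succ (a n), ha, add_zero]
    simp only [sum_range_succ, sum_add_distrib]
    ring

/-- No ALSH family separates the two sides of an infinite half graph. -/
lemma ALSHFamily.not_halfGraph_collision {Z : Type uZ} {Q : Type uQ} {B : Type uB}
    (H : ALSHFamily.{uΩ} Z Q B) (o : ℕ → Z) (q : ℕ → Q) {P₁ P₂ : ℝ} (hP : P₂ < P₁)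
    (h₁ : ∀ i j, i < j → P₁ ≤ H.collisionProb (o i) (q j))
    (h₂ : ∀ i j, i < j → H.collisionProb (o j) (q i) ≤ P₂) : False := by
  obtain ⟨N, hN⟩ := exists_mul_lt_sum_one_div_sub (π / (P₁ - P₂))
  have hpos : 0 < P₁ - P₂ := sub_pos.mpr hP
  have hle := H.sum_collisionProb_div_sub_le o q N
  rw [sum_range_sum_range_eq_of_diag (by simp)] at hle
  have hlow : (P₁ - P₂) * ∑ j ∈ range N, ∑ i ∈ range j, 1 / ((j : ℝ) - i) ≤ π * N := by
    refine le_trans ?_ hle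
    simp_rw [mul_sum]
    refine sum_le_sum fun j _ => sum_le_sum fun i hi => ?_
    have hij := mem_range.mp hi
    have hij' : (0 : ℝ) < (j : ℝ) - i := sub_pos.mpr (by exact_mod_cast hij)
    have hneg : 1 / ((i : ℝ) - j) = -(1 / ((j : ℝ) - i)) := by
      rw [← neg_sub, one_div_neg_eq_neg_one_div]
    rw [hneg, mul_neg, ← sub_eq_add_neg, ← sub_mul]
    exact mul_le_mul_of_nonneg_right (sub_le_sub (h₁ i j hij) (h₂ i j hij)) (by positivity)
  have := mul_lt_mul_of_pos_left hN hpos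
  rw [← mul_assoc, mul_div_cancel₀ _ hpos.ne'] at this
  linarith

/-! ### Weights of both signs -/

/-- The weight vector `(1, -1, 0, …, 0)`. -/
def signedWeight (d : ℕ) (i : Fin d) : ℝ :=
  if (i : ℕ) = 0 then 1 else if (i : ℕ) = 1 then -1 else 0

lemma weightedManhattan_signedWeight {d : ℕ} (hd : 2 ≤ d) {x y : ℝ} (hx : 0 ≤ x) (hy : 0 ≤ y) :
    weightedManhattan (signedWeight d) (fun i => if (i : ℕ) = 0 then x else 0)
      (fun i => if (i : ℕ) = 1 then y else 0) = x - y := by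
  obtain ⟨n, rfl⟩ := Nat.exists_eq_add_of_le' hd
  simp [weightedManhattan, signedWeight, Fin.sum_univ_succ, abs_of_nonneg hx, abs_of_nonneg hy]
  ring

lemma ALSHFamily.not_isSensitive_signedWeight {d : ℕ} (hd : 2 ≤ d) {R₁ R₂ P₁ P₂ : ℝ}
    {B : Type uB} (H : ALSHFamily.{uΩ} (Fin d → ℝ) (Fin d → ℝ) B) :
    ¬ H.IsSensitive (weightedManhattan (signedWeight d)) Set.univ Set.univ R₁ R₂ P₁ P₂ := by
  rintro ⟨h, hR, hP⟩
  have hδ : 0 < R₂ - R₁ := sub_pos.mpr hR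
  -- The shifts `|R₁| + R₁` and `|R₁|` keep both coordinates nonnegative and differ by `R₁`.
  let o : ℕ → Fin d → ℝ := fun i k => if (k : ℕ) = 0 then (R₂ - R₁) * i + (|R₁| + R₁) else 0
  let q : ℕ → Fin d → ℝ := fun j k => if (k : ℕ) = 1 then (R₂ - R₁) * j + |R₁| else 0
  have hdist : ∀ i j, weightedManhattan (signedWeight d) (o i) (q j) =
      R₁ + (R₂ - R₁) * ((i : ℝ) - j) := by
    intro i j
    have h0 : 0 ≤ |R₁| + R₁ := by linarith [neg_abs_le R₁]
    refine (weightedManhattan_signedWeight hd (by positivity) (by positivity)).trans ?_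
    ring
  refine H.not_halfGraph_collision o q hP (fun i j hij => ?_) (fun i j hij => ?_)
  · refine (h (o i) trivial (q j) trivial).1 ?_
    have : (i : ℝ) ≤ j := by exact_mod_cast hij.le
    rw [hdist]
    nlinarith
  · refine (h (o j) trivial (q i) trivial).2 ?_
    have : (i : ℝ) + 1 ≤ j := by exact_mod_cast hij
    rw [hdist]
    nlinarith

/-- An LSH family as the ALSH family that hashes data points and queries alike. -/
def LSHFamily.toALSHFamily {Z : Type uZ} {B : Type uB} (H : LSHFamily.{uΩ} Z B) :
    ALSHFamily.{uΩ} Z Z B where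
  Ω := H.Ω
  mΩ := H.mΩ
  μ := H.μ
  isProb := H.isProb
  f := H.h
  g := H.h
  measurableSet_collision := H.measurableSet_collision

/-- The ALSH family obtained by hashing a new kind of queries through a map `φ` to the old ones. -/
def ALSHFamily.comapQuery {Z : Type uZ} {Q Q' : Type*} {B : Type uB}
    (H : ALSHFamily.{uΩ} Z Q B) (φ : Q' → Q) : ALSHFamily.{uΩ} Z Q' B where
  Ω := H.Ω
  mΩ := H.mΩ
  μ := H.μ
  isProb := H.isProb
  f := H.f
  g := fun ω q => H.g ω (φ q)
  measurableSet_collision := fun o q => H.measurableSet_collision o (φ q)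

theorem theorem2 (d : ℕ) (hd : 3 ≤ d) (R₁ R₂ P₁ P₂ : ℝ) (hR : R₁ < R₂) (hP : P₂ < P₁) :
    -- weights specified along with the query point: no LSH family (the hash function, being
    -- applied to data points as well, cannot involve the weights) ...
    (¬ ∃ (B : Type uB) (H : LSHFamily.{uΩ} (Fin d → ℝ) B), ∀ w : Fin d → ℝ,
        H.IsSensitive (weightedManhattan w) Set.univ Set.univ R₁ R₂ P₁ P₂) ∧
    -- ... and no ALSH family, even if the query hash function sees the weights
    (¬ ∃ (B : Type uB) (H : ALSHFamily.{uΩ} (Fin d → ℝ) ((Fin d → ℝ) × (Fin d → ℝ)) B),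
        H.IsSensitive (fun o qw => weightedManhattan qw.2 o qw.1)
          Set.univ Set.univ R₁ R₂ P₁ P₂) ∧
    -- one single weight vector, known in advance, already excludes both kinds of families
    (∃ w : Fin d → ℝ,
      (¬ ∃ (B : Type uB) (H : LSHFamily.{uΩ} (Fin d → ℝ) B),
        H.IsSensitive (weightedManhattan w) Set.univ Set.univ R₁ R₂ P₁ P₂) ∧
      (¬ ∃ (B : Type uB) (H : ALSHFamily.{uΩ} (Fin d → ℝ) (Fin d → ℝ) B),
        H.IsSensitive (weightedManhattan w) Set.univ Set.univ R₁ R₂ P₁ P₂)) := by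
  have hd : 2 ≤ d := by omega
  refine ⟨?_, ?_, signedWeight d, ?_, ?_⟩
  · rintro ⟨B, H, h⟩
    exact H.toALSHFamily.not_isSensitive_signedWeight hd (h (signedWeight d))
  · rintro ⟨B, H, h⟩
    exact (H.comapQuery fun q => (q, signedWeight d)).not_isSensitive_signedWeight hd
      ⟨fun o _ q _ => h.1 o trivial (q, signedWeight d) trivial, h.2⟩
  · rintro ⟨B, H, h⟩
    exact H.toALSHFamily.not_isSensitive_signedWeight hd h
  · rintro ⟨B, H, h⟩
    exact H.not_isSensitive_signedWeight hd h
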